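/- Let $m\ge 2$ and $n\ge 1$. For a real tensor $\mathcal T=(t_{i_1\cdots i_m})$ of order $m$ and dimension $n$ (indices in $[n]=\{1,\dots,n\}$), a number $\lambda\in\mathbb C$ is an eigenvalue of $\mathcal T$ if there is $x\in\mathbb C^n\setminus\{0\}$ with $$\sum_{i_2,\dots,i_m=1}^n t_{i i_2\cdots i_m}x_{i_2}\cdots x_{i_m}=\lambda x_i^{m-1}\qquad (i\in[n]).$$ Let $\mathrm{Spec}(\mathcal T)$ be the set of all eigenvalues of $\mathcal T$, let $\rho(\mathcal T)=\max\{|\lambda|:\lambda\in\mathrm{Spec}(\mathcal T)\}$ be its spectral radius, and let $|\mathcal T|=(|t_{i_1\cdots i_m}|)$. Let $\mathcal A=\mathcal D-\mathcal C$ be a symmetric $Z$-tensor of order $m$ and dimension $n$ with nonnegative diagonal, where $\mathcal D$ is a nonzero nonnegative diagonal tensor and $\mathcal C=(c_{i_1\cdots i_m})$ is a nonnegative tensor with zero diagonal entries (symmetric means that the entries are invariant under all permutations of their indices). Suppose that $\mathcal C$ is weakly irreducible, that is, the graph on $[n]$ in which distinct $i,j$ are adjacent if and only if $i$ and $j$ occur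 at two positions of the index tuple of some nonzero entry of $\mathcal C$ is connected. Then $$\rho(\mathcal A)=\rho(|\mathcal A|)\quad\Longleftrightarrow\quad \mathrm{Spec}(\mathcal A)=\mathrm{Spec}(|\mathcal A|).$$ -/

import Mathlib

namespace ZTensor

/-- Real tensors of order `m` and dimension `n`: arrays indexed by `m`-tuples from an `n`-element
set. -/
abbrev Tensor (m n : ℕ) : Type := (Fin m → Fin n) → ℝ

/-- The entries are invariant under every permutation of their indices. -/
def IsSymmetric {m n : ℕ} (T : Tensor m n) : Prop :=
  ∀ (σ : Equiv.Perm (Fin m)) (s : Fin m → Fin n), T (s ∘ σ) = T s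

/-- All entries whose indices are not all equal vanish. -/
def IsDiagonal {m n : ℕ} (T : Tensor m n) : Prop :=
  ∀ s : Fin m → Fin n, (¬ ∃ i, s = fun _ => i) → T s = 0

/-- All diagonal entries `t_{ii...i}` vanish. -/
def HasZeroDiagonal {m n : ℕ} (T : Tensor m n) : Prop :=
  ∀ i : Fin n, T (fun _ => i) = 0

/-- All entries are nonnegative. -/
def IsNonneg {m n : ℕ} (T : Tensor m n) : Prop :=
  ∀ s : Fin m → Fin n, 0 ≤ T s

/-- The absolute tensor `|T|`, entry by entry. -/
def absTensor {m n : ℕ} (T : Tensor m n) : Tensor m n :=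
  fun s => |T s|

/-- For `T` of order `m = k + 1` and a complex vector `x`, the vector `T x^{m-1}`, whose `i`-th
component is `∑_{i₂, ..., i_m} t_{i i₂ ... i_m} x_{i₂} ⋯ x_{i_m}`. -/
noncomputable def applyVec {k n : ℕ} (T : Tensor (k + 1) n) (x : Fin n → ℂ) : Fin n → ℂ :=
  fun i => ∑ s : Fin k → Fin n, (T (Fin.cons i s) : ℂ) * ∏ j, x (s j)

/-- `(μ, x)` is an eigenvalue-eigenvector pair: `x ≠ 0` and `T x^{m-1} = μ x^{[m-1]}`,
where `m = k + 1`. -/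
def IsEigenpair {k n : ℕ} (T : Tensor (k + 1) n) (μ : ℂ) (x : Fin n → ℂ) : Prop :=
  x ≠ 0 ∧ ∀ i, applyVec T x i = μ * x i ^ k

/-- The spectrum: the set of all complex eigenvalues. -/
def Spec {k n : ℕ} (T : Tensor (k + 1) n) : Set ℂ :=
  {μ | ∃ x : Fin n → ℂ, IsEigenpair T μ x}

/-- The spectral radius: the largest modulus of an eigenvalue. (The set of moduli is bounded by the
largest absolute row sum, so that the supremum is never taken over an unbounded set.) -/
noncomputable def spectralRad {k n : ℕ} (T : Tensor (k + 1) n) : ℝ :=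
  sSup ((fun μ : ℂ => ‖μ‖) '' Spec T)

/-- The graph of a tensor on its index set: distinct `i` and `j` are joined when they occur at two
positions of the index tuple of a nonzero entry. -/
def indexGraph {m n : ℕ} (T : Tensor m n) : SimpleGraph (Fin n) where
  Adj i j := i ≠ j ∧ ∃ s : Fin m → Fin n, T s ≠ 0 ∧ ∃ p q : Fin m, p ≠ q ∧ s p = i ∧ s q = j
  symm := by
    constructor
    rintro i j ⟨hij, s, hs, p, q, hpq, hp, hq⟩
    exact ⟨hij.symm, s, hs, q, p, hpq.symm, hq, hp⟩
  loopless := by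
    constructor
    rintro i ⟨h, -⟩
    exact h rfl

/-- A tensor is weakly irreducible when its graph is connected. -/
def IsWeaklyIrreducible {m n : ℕ} (T : Tensor m n) : Prop :=
  (indexGraph T).Connected

end ZTensor

namespace ZTensor

open Finset

variable {k m n : ℕ}

/-! Let `M` be the maximum of the form of `|A|` relative to `∑ y_i ^ m` on the nonnegative orthant.
Weak irreducibility makes every nonzero maximizer positive (`pos_of_isMax`), hence by symmetry a
critical point, so `M` is an eigenvalue of `|A|`; the triangle inequality bounds every eigenvalue of
`A` and of `|A|` by `M`. Thus `ρ(|A|) = M`. If `ρ(A) = M`, compactness gives an eigenpair `(μ, x)`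
of `A` with `|μ| = M`. Then `|x|` is a maximizer, so it is positive and all triangle inequalities
are equalities: the nonzero terms of row `i` share the phase of `μ x_i^{m-1}`. A positive diagonal
entry forces `μ = M`, and the phases `x_i / |x_i|` then give a diagonal similarity between `A` and
`|A|`. -/

/-- The homogeneous form `∑ t_{i₁ ... i_m} y_{i₁} ⋯ y_{i_m}` of a tensor on real vectors. -/
noncomputable def form (T : Tensor m n) (y : Fin n → ℝ) : ℝ :=
  ∑ s : Fin m → Fin n, T s * ∏ j, y (s j)

/-- The real counterpart of `applyVec`. -/
noncomputable def applyReal (T : Tensor (k + 1) n) (y : Fin n → ℝ) (i : Fin n) : ℝ :=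
  ∑ s : Fin k → Fin n, T (Fin.cons i s) * ∏ j, y (s j)

theorem form_eq_sum_mul_applyReal (T : Tensor (k + 1) n) (y : Fin n → ℝ) :
    form T y = ∑ i, y i * applyReal T y i := by
  unfold form applyReal
  rw [← (Fin.consEquiv (fun _ : Fin (k + 1) => Fin n)).sum_comp, Fintype.sum_prod_type]
  refine sum_congr rfl fun i _ => ?_
  rw [mul_sum]
  refine sum_congr rfl fun s _ => ?_
  simp only [Fin.consEquiv, Equiv.coe_fn_mk, Fin.prod_univ_succ, Fin.cons_zero, Fin.cons_succ]
  ring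

theorem form_smul (T : Tensor m n) (c : ℝ) (y : Fin n → ℝ) :
    form T (c • y) = c ^ m * form T y := by
  simp only [form, Pi.smul_apply, smul_eq_mul, prod_mul_distrib, prod_const, card_univ,
    Fintype.card_fin, mul_sum]
  exact sum_congr rfl fun s _ => by ring

theorem continuous_form (T : Tensor m n) : Continuous (form T) := by
  unfold form
  fun_prop

theorem IsSymmetric.apply_insertNth {T : Tensor (k + 1) n} (hT : IsSymmetric T)
    (j : Fin (k + 1)) (i : Fin n) (s : Fin k → Fin n) :
    T (j.insertNth i s) = T (Fin.cons i s) := by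
  rw [← hT j.cycleRange (Fin.cons i s)]
  congr 1
  funext l
  simp [Fin.cons_apply_cycleRange]

theorem hasDerivAt_add_smul_single (y : Fin n → ℝ) (i l : Fin n) :
    HasDerivAt (fun t : ℝ => (y + t • (Pi.single i 1 : Fin n → ℝ)) l)
      ((Pi.single i 1 : Fin n → ℝ) l) 0 := by
  simpa using ((hasDerivAt_id (0 : ℝ)).mul_const ((Pi.single i 1 : Fin n → ℝ) l)).const_add (y l)

/-- The product rule gives one sum for each position of the index `i`; by symmetry all of them equal
`applyReal T y i`. -/
theorem hasDerivAt_form {T : Tensor (k + 1) n} (hT : IsSymmetric T) (y : Fin n → ℝ) (i : Fin n) :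
    HasDerivAt (fun t : ℝ => form T (y + t • Pi.single i 1))
      ((k + 1 : ℕ) * applyReal T y i) 0 := by
  have h : HasDerivAt (fun t : ℝ => form T (y + t • Pi.single i 1))
      (∑ s : Fin (k + 1) → Fin n, T s * ∑ j, (∏ l ∈ univ.erase j, y (s l)) *
        (Pi.single i (1 : ℝ) : Fin n → ℝ) (s j)) 0 := by
    unfold form
    refine HasDerivAt.fun_sum fun s _ => HasDerivAt.const_mul _ ?_
    have := HasDerivAt.fun_finsetProd (u := univ)
      (fun j _ => hasDerivAt_add_smul_single y i (s j))
    simpa using this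
  convert h using 1
  simp_rw [mul_sum]
  rw [sum_comm]
  have hj : ∀ j : Fin (k + 1), ∑ s : Fin (k + 1) → Fin n, T s *
      ((∏ l ∈ univ.erase j, y (s l)) * (Pi.single i (1 : ℝ) : Fin n → ℝ) (s j)) =
        applyReal T y i := by
    intro j
    rw [← (Fin.insertNthEquiv (fun _ : Fin (k + 1) => Fin n) j).sum_comp, Fintype.sum_prod_type,
      sum_eq_single i]
    · refine sum_congr rfl fun s _ => ?_
      have : (univ.erase j : Finset (Fin (k + 1))) = univ.map j.succAboveEmb := by
        ext l; simp [Fin.exists_succAbove_eq_iff]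
      have hs := hT.apply_insertNth j i s
      simp [Fin.insertNthEquiv, hs, this]
    · intro b _ hb
      simp [hb]
    · simp
  simp [hj]

/-! ### Maximizers of the form -/

/-- A positive vector at which the form of a symmetric tensor reaches its bound `M` relative to
`∑ y_i ^ m` is an eigenvector for `M`. -/
theorem applyReal_eq_of_isMax {T : Tensor (k + 1) n} (hT : IsSymmetric T) {M : ℝ}
    (hM : ∀ y : Fin n → ℝ, (∀ i, 0 ≤ y i) → form T y ≤ M * ∑ i, y i ^ (k + 1))
    {y : Fin n → ℝ} (hy : ∀ i, 0 < y i) (heq : form T y = M * ∑ i, y i ^ (k + 1)) (i : Fin n) :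
    applyReal T y i = M * y i ^ k := by
  have hpow : HasDerivAt (fun t : ℝ => ∑ l, (y + t • (Pi.single i 1 : Fin n → ℝ)) l ^ (k + 1))
      ((k + 1 : ℕ) * y i ^ k) 0 := by
    have h : HasDerivAt (fun t : ℝ => ∑ l, (y + t • (Pi.single i 1 : Fin n → ℝ)) l ^ (k + 1))
        (∑ l, (k + 1 : ℕ) * y l ^ k * (Pi.single i (1 : ℝ) : Fin n → ℝ) l) 0 := by
      refine HasDerivAt.fun_sum fun l _ => ?_
      simpa using (hasDerivAt_add_smul_single y i l).fun_pow (k + 1)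
    simpa [Pi.single_apply] using h
  have hd := (hpow.const_mul M).sub (hasDerivAt_form hT y i)
  -- Since `y i > 0`, small negative `t` also stay in the orthant, so the minimum is two-sided.
  have hmin : IsLocalMin (fun t : ℝ => M * ∑ l, (y + t • (Pi.single i 1 : Fin n → ℝ)) l ^ (k + 1) -
      form T (y + t • Pi.single i 1)) 0 := by
    have hev : ∀ᶠ t : ℝ in nhds 0, -y i < t := lt_mem_nhds (by linarith [hy i])
    filter_upwards [hev] with t ht
    have := hM (y + t • Pi.single i 1) (fun l => by
      rcases eq_or_ne l i with rfl | hl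
      · simp; linarith
      · simpa [hl] using (hy l).le)
    simp only [zero_smul, add_zero]
    linarith
  have h0 := hmin.hasDerivAt_eq_zero hd
  have hk : ((k + 1 : ℕ) : ℝ) ≠ 0 := by positivity
  apply mul_left_cancel₀ hk
  linarith

/-- A nonzero nonnegative vector at which the form of a weakly irreducible tensor reaches its
bound is positive. -/
theorem pos_of_isMax {T : Tensor (k + 1) n} (hT : IsNonneg T) (hirr : IsWeaklyIrreducible T)
    {M : ℝ} (hM : ∀ y : Fin n → ℝ, (∀ i, 0 ≤ y i) → form T y ≤ M * ∑ i, y i ^ (k + 1))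
    {y : Fin n → ℝ} (hy : ∀ i, 0 ≤ y i) (hy0 : y ≠ 0)
    (heq : form T y = M * ∑ i, y i ^ (k + 1)) (i : Fin n) : 0 < y i := by
  by_contra hi
  replace hi : y i = 0 := le_antisymm (not_lt.1 hi) (hy i)
  obtain ⟨j, hj⟩ := Function.ne_iff.1 hy0
  obtain ⟨w⟩ := hirr.preconnected i j
  -- A walk from a zero of `y` to a nonzero coordinate crosses over at some edge, so some nonzero
  -- entry `s` involves both kinds of index.
  obtain ⟨d, -, hd1, hd2⟩ := w.exists_boundary_dart {l | y l = 0} hi hj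
  obtain ⟨-, s, hs, p, q, hpq, hp, hq⟩ := d.adj
  replace hd1 : y (s p) = 0 := by rw [hp]; exact hd1
  replace hd2 : y (s q) ≠ 0 := by rw [hq]; exact hd2
  -- Raise the zeros of `y` to `t`. Entry `s` has at most `k` vanishing factors, so the form gains
  -- at least `c * t ^ k`, while `∑ y_i ^ (k + 1)` gains only `N * t ^ (k + 1)`: impossible for
  -- small `t`.
  set e : Fin n → ℝ := fun l => if y l = 0 then 1 else 0 with he
  have he01 : ∀ l, 0 ≤ e l := fun l => by simp only [he]; split_ifs <;> norm_num
  set b : Fin n → ℝ := fun l => if y l = 0 then 1 else y l with hb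
  have hbpos : ∀ l, 0 < b l := fun l => by
    simp only [hb]; split_ifs with h
    · norm_num
    · exact lt_of_le_of_ne (hy l) (Ne.symm h)
  set c : ℝ := T s * ∏ l, b (s l) with hc
  have hcpos : 0 < c := mul_pos (lt_of_le_of_ne (hT s) hs.symm) (prod_pos fun l _ => hbpos _)
  set N : ℝ := ∑ l, e l with hN
  have hlow : ∀ t : ℝ, 0 < t → t ≤ 1 → form T y + c * t ^ k ≤ form T (y + t • e) := by
    intro t ht ht1
    have hterm : ∀ r : Fin (k + 1) → Fin n,
        T r * ∏ l, y (r l) + (if r = s then c * t ^ k else 0) ≤ T r * ∏ l, (y + t • e) (r l) := by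
      intro r
      split_ifs with hr
      · subst hr
        rw [prod_eq_zero (mem_univ p) hd1, mul_zero, zero_add, hc, mul_assoc]
        refine mul_le_mul_of_nonneg_left ?_ (hT r)
        rw [← mul_prod_erase univ _ (mem_univ q), ← mul_prod_erase univ (fun l => (y + t • e) (r l))
          (mem_univ q), mul_assoc]
        have h1 : (y + t • e) (r q) = b (r q) := by simp [he, hb, hd2]
        rw [h1]
        refine mul_le_mul_of_nonneg_left ?_ (hbpos _).le
        have h2 : t ^ k = ∏ _l ∈ univ.erase q, t := by simp
        rw [h2, ← prod_mul_distrib]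
        refine prod_le_prod (fun l _ => (mul_pos (hbpos _) ht).le) fun l _ => ?_
        by_cases h : y (r l) = 0
        · simp [he, hb, h]
        · simpa [he, hb, h] using mul_le_of_le_one_right (hy (r l)) ht1
      · rw [add_zero]
        refine mul_le_mul_of_nonneg_left (prod_le_prod (fun l _ => hy _) fun l _ => ?_) (hT r)
        simpa using mul_nonneg ht.le (he01 _)
    have := sum_le_sum fun r (_ : r ∈ univ) => hterm r
    rw [sum_add_distrib] at this
    simpa [form] using this
  have hup : ∀ t : ℝ, ∑ l, (y + t • e) l ^ (k + 1) = ∑ l, y l ^ (k + 1) + t ^ (k + 1) * N := by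
    intro t
    rw [hN, mul_sum, ← sum_add_distrib]
    refine sum_congr rfl fun l _ => ?_
    by_cases h : y l = 0 <;> simp [he, h]
  have hkey : ∀ t : ℝ, 0 < t → t ≤ 1 → c ≤ M * N * t := by
    intro t ht ht1
    have h1 := hlow t ht ht1
    have h2 := hM (y + t • e) fun l => add_nonneg (hy l) (mul_nonneg ht.le (he01 l))
    rw [hup] at h2
    have h3 : c * t ^ k ≤ (M * N * t) * t ^ k := by
      rw [pow_succ] at h2
      linarith
    exact le_of_mul_le_mul_right h3 (pow_pos ht k)
  have hMN : 0 < M * N := by linarith [hkey 1 one_pos le_rfl]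
  -- This value of `t` turns `hkey` into `c ≤ c / 2`; it is at most `1` by `hkey` at `t = 1`.
  have ht : 0 < c / (2 * (M * N)) := by positivity
  have h1 := hkey _ ht (by
    rw [div_le_one (by positivity)]
    linarith [hkey 1 one_pos le_rfl])
  have h2 : M * N * (c / (2 * (M * N))) = c / 2 := by
    rw [← div_div, mul_div_cancel₀ _ hMN.ne']
  linarith

/-- The form of a tensor attains its maximum relative to `∑ y_i ^ m` on the nonnegative orthant. -/
theorem exists_isMax (hn : 0 < n) (T : Tensor (k + 1) n) :
    ∃ M : ℝ, (∀ y : Fin n → ℝ, (∀ i, 0 ≤ y i) → form T y ≤ M * ∑ i, y i ^ (k + 1)) ∧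
      ∃ y : Fin n → ℝ, (∀ i, 0 ≤ y i) ∧ y ≠ 0 ∧ form T y = M * ∑ i, y i ^ (k + 1) := by
  set K : Set (Fin n → ℝ) := {y | (∀ i, 0 ≤ y i) ∧ ∑ i, y i ^ (k + 1) = 1} with hK
  have hcomp : IsCompact K := by
    refine (isCompact_Icc (a := (0 : Fin n → ℝ)) (b := 1)).of_isClosed_subset ?_ ?_
    · have h1 : IsClosed {y : Fin n → ℝ | ∀ i, 0 ≤ y i} := by
        simp only [Set.ofPred_forall]
        exact isClosed_iInter fun i => isClosed_le continuous_const (continuous_apply i)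
      exact h1.inter (isClosed_eq (by fun_prop) continuous_const)
    · rintro y ⟨hy, hs⟩
      refine ⟨hy, fun i => ?_⟩
      have : y i ^ (k + 1) ≤ 1 := by
        rw [← hs]
        exact single_le_sum (f := fun i => y i ^ (k + 1)) (fun l _ => pow_nonneg (hy l) _)
          (mem_univ i)
      exact (pow_le_one_iff_of_nonneg (hy i) k.succ_ne_zero).1 this
  have hne : K.Nonempty := by
    refine ⟨Pi.single ⟨0, hn⟩ 1, fun i => ?_, ?_⟩
    · exact (Pi.single_nonneg.2 zero_le_one : (0 : Fin n → ℝ) ≤ _) i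
    · rw [sum_eq_single ⟨0, hn⟩] <;> simp +contextual
  obtain ⟨y, ⟨hy, hys⟩, hmax⟩ := hcomp.exists_isMaxOn hne (continuous_form T).continuousOn
  refine ⟨form T y, fun z hz => ?_, y, hy, ?_, by rw [hys, mul_one]⟩
  · set S := ∑ i, z i ^ (k + 1) with hS
    have hS0 : 0 ≤ S := sum_nonneg fun i _ => pow_nonneg (hz i) _
    rcases hS0.eq_or_lt with h0 | hpos
    · have hz0 : z = 0 := by
        funext i
        have := (sum_eq_zero_iff_of_nonneg fun i _ => pow_nonneg (hz i) (k + 1)).1 h0.symm i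
          (mem_univ i)
        exact pow_eq_zero_iff k.succ_ne_zero |>.1 this
      rw [← h0, hz0]
      simp [form]
    · set c : ℝ := S ^ (((k + 1 : ℕ) : ℝ)⁻¹) with hc
      have hcpos : 0 < c := Real.rpow_pos_of_pos hpos _
      have hcpow : c ^ (k + 1) = S := Real.rpow_inv_natCast_pow hS0 k.succ_ne_zero
      have hmem : c⁻¹ • z ∈ K := by
        refine ⟨fun i => mul_nonneg (inv_nonneg.2 hcpos.le) (hz i), ?_⟩
        simp only [Pi.smul_apply, smul_eq_mul, mul_pow, ← mul_sum]
        rw [← hS, inv_pow, hcpow, inv_mul_cancel₀ hpos.ne']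
      have h := hmax hmem
      simp only [Set.mem_ofPred_eq, form_smul, inv_pow, hcpow] at h
      rwa [inv_mul_le_iff₀ hpos, mul_comm] at h
  · rintro rfl
    simp at hys

/-! ### Complex eigenpairs and the bound on the spectrum -/

theorem applyVec_ofReal (T : Tensor (k + 1) n) (y : Fin n → ℝ) (i : Fin n) :
    applyVec T (fun l => (y l : ℂ)) i = (applyReal T y i : ℂ) := by
  simp [applyVec, applyReal]

theorem norm_applyVec_le (T : Tensor (k + 1) n) (x : Fin n → ℂ) (i : Fin n) :
    ‖applyVec T x i‖ ≤ applyReal (absTensor T) (fun l => ‖x l‖) i := by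
  refine (norm_sum_le _ _).trans_eq (sum_congr rfl fun s _ => ?_)
  simp [absTensor]

theorem sum_norm_pow_pos {x : Fin n → ℂ} (hx : x ≠ 0) (p : ℕ) : 0 < ∑ i, ‖x i‖ ^ p := by
  obtain ⟨i, hi⟩ := Function.ne_iff.1 hx
  exact sum_pos' (fun l _ => pow_nonneg (norm_nonneg _) _) ⟨i, mem_univ i,
    pow_pos (norm_pos_iff.2 hi) _⟩

theorem norm_mul_sum_le_form {T : Tensor (k + 1) n} {μ : ℂ} {x : Fin n → ℂ}
    (h : IsEigenpair T μ x) :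
    ‖μ‖ * ∑ i, ‖x i‖ ^ (k + 1) ≤ form (absTensor T) (fun l => ‖x l‖) := by
  rw [form_eq_sum_mul_applyReal, mul_sum]
  refine sum_le_sum fun i _ => ?_
  have := norm_applyVec_le T x i
  rw [h.2 i, norm_mul, norm_pow] at this
  calc ‖μ‖ * ‖x i‖ ^ (k + 1) = ‖x i‖ * (‖μ‖ * ‖x i‖ ^ k) := by ring
    _ ≤ _ := mul_le_mul_of_nonneg_left this (norm_nonneg _)

theorem norm_le_of_mem_spec {T : Tensor (k + 1) n} {M : ℝ}
    (hM : ∀ y : Fin n → ℝ, (∀ i, 0 ≤ y i) → form (absTensor T) y ≤ M * ∑ i, y i ^ (k + 1))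
    {μ : ℂ} (hμ : μ ∈ Spec T) : ‖μ‖ ≤ M := by
  obtain ⟨x, hx⟩ := hμ
  exact le_of_mul_le_mul_right ((norm_mul_sum_le_form hx).trans (hM _ fun i => norm_nonneg _))
    (sum_norm_pow_pos hx.1 _)

theorem IsEigenpair.smul {T : Tensor (k + 1) n} {μ : ℂ} {x : Fin n → ℂ}
    (h : IsEigenpair T μ x) {c : ℂ} (hc : c ≠ 0) : IsEigenpair T μ (c • x) := by
  refine ⟨smul_ne_zero hc h.1, fun i => ?_⟩
  have : applyVec T (c • x) i = c ^ k * applyVec T x i := by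
    simp only [applyVec, Pi.smul_apply, smul_eq_mul, prod_mul_distrib, prod_const, card_univ,
      Fintype.card_fin, mul_sum]
    exact sum_congr rfl fun s _ => by ring
  rw [this, h.2 i, Pi.smul_apply, smul_eq_mul]
  ring

/-- A bounded spectrum is compact. -/
theorem isCompact_spec {T : Tensor (k + 1) n} {M : ℝ} (hM : ∀ μ ∈ Spec T, ‖μ‖ ≤ M) :
    IsCompact (Spec T) := by
  -- By homogeneity eigenvectors can be taken on the unit sphere; the spectrum is then the
  -- projection of a compact set of pairs.
  have hK : IsCompact {p : ℂ × (Fin n → ℂ) | p ∈ Metric.closedBall (0 : ℂ) M ×ˢ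
      Metric.sphere (0 : Fin n → ℂ) 1 ∧ ∀ i, applyVec T p.2 i = p.1 * p.2 i ^ k} := by
    have hclosed : IsClosed {p : ℂ × (Fin n → ℂ) | ∀ i, applyVec T p.2 i = p.1 * p.2 i ^ k} := by
      simp only [Set.ofPred_forall]
      refine isClosed_iInter fun i => isClosed_eq ?_ ?_
      · unfold applyVec
        fun_prop
      · fun_prop
    exact ((isCompact_closedBall _ _).prod (isCompact_sphere _ _)).inter_right hclosed
  convert hK.image continuous_fst
  ext μ
  constructor
  · rintro ⟨x, hx⟩
    have hn : (‖x‖ : ℂ) ≠ 0 := by simpa using hx.1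
    have hs := hx.smul (inv_ne_zero hn)
    refine ⟨(μ, (‖x‖ : ℂ)⁻¹ • x), ⟨⟨by simpa using hM μ ⟨x, hx⟩, ?_⟩, hs.2⟩, rfl⟩
    have : ‖x‖ ≠ 0 := by simpa using hx.1
    simp [norm_smul, this]
  · rintro ⟨⟨μ, x⟩, ⟨⟨-, hx⟩, hs⟩, rfl⟩
    refine ⟨x, ?_, hs⟩
    rintro rfl
    simp at hx

/-! ### Diagonal similarity and phases -/

/-- Multiplying by a vector without zeros maps eigenvectors of `T'` to eigenvectors of `T`. -/
theorem spec_subset_of_diagonal_similar {T T' : Tensor (k + 1) n} {u : Fin n → ℂ}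
    (hu : ∀ i, u i ≠ 0)
    (h : ∀ i s, (T (Fin.cons i s) : ℂ) * ∏ j, u (s j) = T' (Fin.cons i s) * u i ^ k) :
    Spec T' ⊆ Spec T := by
  rintro μ ⟨x, hx0, hx⟩
  refine ⟨u * x, ?_, fun i => ?_⟩
  · obtain ⟨i, hi⟩ := Function.ne_iff.1 hx0
    exact Function.ne_iff.2 ⟨i, mul_ne_zero (hu i) hi⟩
  · have : applyVec T (u * x) i = u i ^ k * applyVec T' x i := by
      simp only [applyVec, Pi.mul_apply, prod_mul_distrib, mul_sum]
      refine sum_congr rfl fun s _ => ?_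
      rw [← mul_assoc, h]
      ring
    rw [this, hx, Pi.mul_apply]
    ring

theorem spec_eq_of_diagonal_similar {T T' : Tensor (k + 1) n} {u : Fin n → ℂ}
    (hu : ∀ i, u i ≠ 0)
    (h : ∀ i s, (T (Fin.cons i s) : ℂ) * ∏ j, u (s j) = T' (Fin.cons i s) * u i ^ k) :
    Spec T = Spec T' := by
  refine Set.Subset.antisymm (spec_subset_of_diagonal_similar (u := u⁻¹)
    (fun i => inv_ne_zero (hu i)) fun i s => ?_) (spec_subset_of_diagonal_similar hu h)
  have hp : ∏ j, u (s j) ≠ 0 := prod_ne_zero_iff.2 fun j _ => hu _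
  have hi : u i ^ k ≠ 0 := pow_ne_zero _ (hu i)
  simp only [Pi.inv_apply, prod_inv_distrib, inv_pow]
  rw [← div_eq_mul_inv, ← div_eq_mul_inv, div_eq_div_iff hp hi, h]

/-- In the equality case of the triangle inequality all summands are nonnegative multiples of the
sum. -/
theorem norm_sum_mul_eq_of_norm_sum_eq {ι : Type*} [Fintype ι] {f : ι → ℂ}
    (h : ‖∑ s, f s‖ = ∑ s, ‖f s‖) (s : ι) :
    (‖∑ r, f r‖ : ℂ) * f s = ‖f s‖ * ∑ r, f r := by
  set S := ∑ r, f r with hS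
  rcases eq_or_ne S 0 with h0 | h0
  · simp [h0]
  -- These bounds add up to an equality, so each is tight and `conj S * f s` is real and
  -- nonnegative.
  have hle : ∀ r, ((starRingEnd ℂ) S * f r).re ≤ ‖S‖ * ‖f r‖ := fun r => by
    simpa using Complex.re_le_norm ((starRingEnd ℂ) S * f r)
  have hsum : ∑ r, ((starRingEnd ℂ) S * f r).re = ∑ r, ‖S‖ * ‖f r‖ := by
    rw [← mul_sum, ← h, ← Complex.re_sum, ← mul_sum, ← hS, ← Complex.normSq_eq_conj_mul_self,
      Complex.ofReal_re, Complex.normSq_eq_norm_sq, sq]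
  have heq := (sum_eq_sum_iff_of_le fun r _ => hle r).1 hsum s (mem_univ s)
  have hre : ((starRingEnd ℂ) S * f s).re = ‖(starRingEnd ℂ) S * f s‖ := by simpa using heq
  have hz : (starRingEnd ℂ) S * f s = ‖S‖ * ‖f s‖ := by
    have := Complex.re_eq_norm.1 hre
    rw [Complex.eq_coe_norm_of_nonneg this]
    simp
  have hSS : S * (starRingEnd ℂ) S = (‖S‖ : ℂ) ^ 2 := Complex.mul_conj' S
  have hn : (‖S‖ : ℂ) ≠ 0 := by simpa using h0
  apply mul_left_cancel₀ hn
  linear_combination S * hz - f s * hSS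

theorem eq_cons_const (i : Fin n) : (fun _ : Fin (k + 1) => i) = Fin.cons i fun _ => i := by
  funext j
  refine Fin.cases ?_ (fun j => ?_) j <;> simp

/-- If the bound on the form of `|T|` is the modulus of an eigenvalue of `T`, and some
diagonal entry of `T` is positive, then `T` and `|T|` have the same spectrum. -/
theorem spec_eq_spec_absTensor {T : Tensor (k + 1) n} (hirr : IsWeaklyIrreducible (absTensor T))
    {M : ℝ} (hMpos : 0 < M)
    (hM : ∀ y : Fin n → ℝ, (∀ i, 0 ≤ y i) → form (absTensor T) y ≤ M * ∑ i, y i ^ (k + 1))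
    {i₀ : Fin n} (hi₀ : 0 < T fun _ => i₀) {μ : ℂ} (hμ : μ ∈ Spec T) (hμM : ‖μ‖ = M) :
    Spec T = Spec (absTensor T) := by
  obtain ⟨x, hx⟩ := hμ
  set y : Fin n → ℝ := fun l => ‖x l‖ with hy
  have hy0 : ∀ i, 0 ≤ y i := fun i => norm_nonneg _
  have hform : form (absTensor T) y = M * ∑ i, y i ^ (k + 1) :=
    le_antisymm (hM y hy0) (hμM ▸ norm_mul_sum_le_form hx)
  have hyne : y ≠ 0 := by
    obtain ⟨i, hi⟩ := Function.ne_iff.1 hx.1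
    exact Function.ne_iff.2 ⟨i, norm_ne_zero_iff.2 hi⟩
  have hypos : ∀ i, 0 < y i :=
    pos_of_isMax (fun s => abs_nonneg _) hirr hM hy0 hyne hform
  have hle : ∀ i, M * y i ^ k ≤ applyReal (absTensor T) y i := fun i => by
    have := norm_applyVec_le T x i
    rwa [hx.2 i, norm_mul, norm_pow, hμM] at this
  -- The row inequalities `hle`, weighted by the positive `y i`, sum to an equality.
  have heq : ∀ i, M * y i ^ k = applyReal (absTensor T) y i := by
    have hs : ∑ i, y i * (M * y i ^ k) = ∑ i, y i * applyReal (absTensor T) y i := by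
      rw [← form_eq_sum_mul_applyReal, hform, mul_sum]
      exact sum_congr rfl fun i _ => by ring
    intro i
    have := (sum_eq_sum_iff_of_le fun i _ => mul_le_mul_of_nonneg_left (hle i) (hy0 i)).1 hs i
      (mem_univ i)
    exact mul_left_cancel₀ (hypos i).ne' this
  have hyc : ∀ i, (y i : ℂ) ≠ 0 := fun i => by exact_mod_cast (hypos i).ne'
  have hMc : (M : ℂ) ≠ 0 := by exact_mod_cast hMpos.ne'
  have hphase : ∀ i s, (M : ℂ) * y i ^ k * (T (Fin.cons i s) * ∏ j, x (s j)) =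
      (absTensor T (Fin.cons i s) * ∏ j, (y (s j) : ℂ)) * (μ * x i ^ k) := by
    intro i s
    have hS : ∑ s, (T (Fin.cons i s) : ℂ) * ∏ j, x (s j) = μ * x i ^ k := hx.2 i
    have hnorm : ∀ s : Fin k → Fin n, ‖(T (Fin.cons i s) : ℂ) * ∏ j, x (s j)‖ =
        absTensor T (Fin.cons i s) * ∏ j, y (s j) := fun s => by simp [absTensor, hy]
    have hSn : ‖μ * x i ^ k‖ = M * y i ^ k := by rw [norm_mul, norm_pow, hμM]
    have := norm_sum_mul_eq_of_norm_sum_eq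
      (f := fun s => (T (Fin.cons i s) : ℂ) * ∏ j, x (s j))
      (by simp only [hnorm]; rw [hS, hSn, heq]; rfl) s
    simp only [hnorm] at this
    rw [hS, hSn] at this
    push_cast at this
    exact this
  have hxne : ∀ i, x i ≠ 0 := fun i => norm_pos_iff.1 (hypos i)
  -- In the diagonal term at `i₀` the factor `x i₀ ^ k` occurs on both sides and cancels.
  have hμeq : μ = M := by
    have h := hphase i₀ fun _ => i₀
    rw [← eq_cons_const] at h
    simp only [prod_const, card_univ, Fintype.card_fin, absTensor, abs_of_pos hi₀] at h
    have hT : ((T fun _ => i₀ : ℝ) : ℂ) ≠ 0 := by exact_mod_cast hi₀.ne'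
    have hc : (y i₀ : ℂ) ^ k * (T fun _ => i₀ : ℝ) * x i₀ ^ k ≠ 0 :=
      mul_ne_zero (mul_ne_zero (pow_ne_zero _ (hyc _)) hT) (pow_ne_zero _ (hxne _))
    apply mul_left_cancel₀ hc
    linear_combination -h
  refine spec_eq_of_diagonal_similar (u := fun i => x i / y i)
    (fun i => div_ne_zero (hxne i) (hyc i)) fun i s => ?_
  have hp : ∏ j, (y (s j) : ℂ) ≠ 0 := prod_ne_zero_iff.2 fun j _ => hyc _
  have hi : (y i : ℂ) ^ k ≠ 0 := pow_ne_zero _ (hyc i)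
  rw [prod_div_distrib, div_pow, ← mul_div_assoc, ← mul_div_assoc, div_eq_div_iff hp hi]
  apply mul_left_cancel₀ hMc
  have := hphase i s
  rw [hμeq] at this
  linear_combination this

/-- For a symmetric tensor with weakly irreducible absolute tensor and a positive diagonal entry,
equality of the spectral radii of `T` and `|T|` amounts to equality of their spectra. -/
theorem spectralRad_eq_iff_spec_eq {T : Tensor (k + 1) n}
    (hsymm : IsSymmetric T) (hirr : IsWeaklyIrreducible (absTensor T))
    {i₀ : Fin n} (hi₀ : 0 < T fun _ => i₀) :
    spectralRad T = spectralRad (absTensor T) ↔ Spec T = Spec (absTensor T) := by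
  refine ⟨fun h => ?_, fun h => by rw [spectralRad, h, spectralRad]⟩
  obtain ⟨M, hM, y, hy, hy0, hform⟩ := exists_isMax (k := k) i₀.pos (absTensor T)
  have hsymm' : IsSymmetric (absTensor T) := fun σ s => by simp only [absTensor, hsymm σ s]
  have habs : absTensor (absTensor T) = absTensor T := funext fun s => abs_abs _
  have hypos := pos_of_isMax (fun s => abs_nonneg _) hirr hM hy hy0 hform
  have heig := applyReal_eq_of_isMax hsymm' hM hypos hform
  have hMpos : 0 < M := by
    have hlt : 0 < applyReal (absTensor T) y i₀ := by
      refine sum_pos' (fun s _ => mul_nonneg (abs_nonneg _) (prod_nonneg fun j _ => hy _))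
        ⟨fun _ => i₀, mem_univ _, mul_pos ?_ (prod_pos fun j _ => hypos _)⟩
      rw [← eq_cons_const]
      exact abs_pos_of_pos hi₀
    rw [heig] at hlt
    exact pos_of_mul_pos_left hlt (pow_nonneg (hy i₀) k)
  have hMmem : (M : ℂ) ∈ Spec (absTensor T) := by
    refine ⟨fun l => (y l : ℂ), Function.ne_iff.2 ⟨i₀, ?_⟩, fun i => ?_⟩
    · simpa using (hypos i₀).ne'
    · rw [applyVec_ofReal, heig]
      push_cast
      rfl
  have hrad : spectralRad (absTensor T) = M := by
    refine IsGreatest.csSup_eq ⟨⟨(M : ℂ), hMmem, by simp [abs_of_pos hMpos]⟩, ?_⟩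
    rintro _ ⟨μ, hμ, rfl⟩
    exact norm_le_of_mem_spec (by rwa [habs]) hμ
  -- An empty spectrum would give `spectralRad T = sSup ∅ = 0`, whereas `M > 0`.
  have hne : (Spec T).Nonempty := by
    by_contra hemp
    rw [Set.not_nonempty_iff_eq_empty] at hemp
    rw [hrad, spectralRad, hemp, Set.image_empty, Real.sSup_empty] at h
    exact hMpos.ne h
  obtain ⟨μ, hμ, hμM⟩ := ((isCompact_spec fun μ => norm_le_of_mem_spec hM).image
    continuous_norm).sSup_mem (hne.image _)
  exact spec_eq_spec_absTensor hirr hMpos hM hi₀ hμ (hμM.trans (h.trans hrad))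

end ZTensor

theorem mainTheorem5 (k n : ℕ) (hk : 1 ≤ k) (A D C : ZTensor.Tensor (k + 1) n)
    (hA : A = D - C)
    (hD_diag : ZTensor.IsDiagonal D) (hD_nonneg : ZTensor.IsNonneg D) (hD_ne : D ≠ 0)
    (hC_nonneg : ZTensor.IsNonneg C) (hC_diag : ZTensor.HasZeroDiagonal C)
    (hA_symm : ZTensor.IsSymmetric A) (hC_irr : ZTensor.IsWeaklyIrreducible C) :
    ZTensor.spectralRad A = ZTensor.spectralRad (ZTensor.absTensor A) ↔
      ZTensor.Spec A = ZTensor.Spec (ZTensor.absTensor A) := by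
  obtain ⟨s, hs⟩ := Function.ne_iff.1 hD_ne
  have hs' : ∃ i, s = fun _ => i := by
    by_contra h
    exact hs (hD_diag s h)
  obtain ⟨i₀, rfl⟩ := hs'
  refine ZTensor.spectralRad_eq_iff_spec_eq (i₀ := i₀) hA_symm ?_ ?_
  · refine SimpleGraph.Connected.mono ?_ hC_irr
    rintro i j ⟨hij, r, hr, hpq⟩
    refine ⟨hij, r, ?_, hpq⟩
    -- A nonzero entry of `C` is off the diagonal, so `D` vanishes there and cannot cancel it in
    -- `A`.
    have hDr : D r = 0 := hD_diag r fun ⟨l, hl⟩ => hr (hl ▸ hC_diag l)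
    simpa [ZTensor.absTensor, hA, hDr] using hr
  · have hC0 : C (fun _ => i₀) = 0 := hC_diag i₀
    simpa [hA, hC0] using lt_of_le_of_ne (hD_nonneg _) (Ne.symm hs)
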